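/- Let $k$ be a field, $R=k[x_1,\dots,x_n]$, and let $\mathcal M$ be the set of monomials of $R$ and $\mathcal M_d=\{m\mathbf e_i : m\in\mathcal M,\ 1\le i\le d\}$ the set of module monomials of $R^d$. Let $\le_m$ be an admissible monomial order on $\mathcal M$ (a linear order with $1\le_m m$, and $m_1\le_m m_2\Rightarrow m_1t\le_m m_2t$). Let $\le_s$ be an admissible module order on $\mathcal M_d$: a linear order with $\mathbf e_i\le_s m\mathbf e_i$, and $\mathbf s\le_s\mathbf t\Rightarrow m\mathbf s\le_s m\mathbf t$ for all $m\in\mathcal M$, $\mathbf s,\mathbf t\in\mathcal M_d$. Assume that the two orders are compatible: $\sigma\mathbf e_j\le_s\tau\mathbf e_j\iff\sigma\le_m\tau$. For a pair $(\mathbf u,p)\in R^d\times R$ with $\mathbf u\ne 0$, its signature is $\mathrm{lm}(\mathbf u)$ with respect to $\le_s$; it is called a syzygy if $p=0$. Leading monomials of polynomials are taken with respect to $\le_m$. Let $B$ be a set of pairs. * $(\mathbf u,p)$ with $p\ne0$ is *ts-rewritable* by $B$ if there are $(\mathbf v,q)\in B$ with $\mathbf v\neq 0$ and $\lambda\in\mathcal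 M$ with $\lambda\,\mathrm{lm}(\mathbf v)=\mathrm{lm}(\mathbf u)$ and either $q=0$ or $\lambda\,\mathrm{lm}(q)<_m\mathrm{lm}(p)$. * $(\mathbf u,p)$ with $p\neq0$ is *tm-reducible* by $B$ if there are $(\mathbf v,q)\in B$ with $\mathbf v\ne0$, $q\ne0$ and $\lambda\in\mathcal M$ with $\lambda\,\mathrm{lm}(q)=\mathrm{lm}(p)$ and $\lambda\,\mathrm{lm}(\mathbf v)<_s\mathrm{lm}(\mathbf u)$; it is then replaced by $(\mathbf u,p)-\frac{\mathrm{lc}(p)}{\mathrm{lc}(q)}\lambda(\mathbf v,q)$. * For two non-syzygies $(\mathbf u_1,p_1),(\mathbf u_2,p_2)$ put $m_i=\mathrm{lcm}(\mathrm{lm}(p_1),\mathrm{lm}(p_2))/\mathrm{lm}(p_i)$. Their J-pair is $m_1(\mathbf u_1,p_1)$ if $m_1\mathrm{lm}(\mathbf u_1)>_s m_2\mathrm{lm}(\mathbf u_2)$, is $m_2(\mathbf u_2,p_2)$ if $m_2\mathrm{lm}(\mathbf u_2)>_s m_1\mathrm{lm}(\mathbf u_1)$, and does not exist if these are equal. The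 *GVWHS algorithm*, on input a finite list $F$ of $d$ polynomials, works as follows. 1. Interreduce $F$: as long as possible, cancel a term of one polynomial that is divisible by the leading monomial of another one, or drop a zero polynomial. Sort the result by ascending leading monomial; call it $f_1,\dots,f_{d'}$ ($d'\le d$). 2. Put $CPs=\{(\mathbf e_i,f_i): 1\le i\le d'\}$ and $SG=\{(f_i\mathbf e_j-f_j\mathbf e_i,0):1\le i<j\le d'\}$. 3. While $CPs\neq\emptyset$: remove from $CPs$ an element $cp$ of minimal signature. If $cp$ is not ts-rewritable by $SG$, tm-reduce it repeatedly by $SG$ until a pair $sp=(\mathbf u,g)$ is reached that is not tm-reducible by $SG$. If $g\neq0$, let $G_1$ be the set of non-syzygies of $SG$, add to $CPs$ all J-pairs of $sp$ with elements of $G_1$, keep in $CPs$ for each distinct signature only one pair, of minimal leading monomial (of its second component), and add to $SG$ all $(g\mathbf u_l-g_l\mathbf u,0)$ with $(\mathbf u_l,g_l)\in G_1$. In either case add $sp$ to $SG$. 4. Return $\{g\ne0: (\mathbf u,g)\in SG\}$. **Theorem.** For every finite list $F$ of $d$ polynomials in $R$, every run of the GVWHS algorithm (whatever choices are made where the description leaves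 them open) terminates after finitely many elementary steps, and its output is a Gröbner basis of the ideal $\langle F\rangle$ with respect to $\le_m$: a finite subset $G$ of the ideal such that the leading monomial of every nonzero element of the ideal is divisible by the leading monomial of some nonzero $g\in G$. -/

import Mathlib

namespace GVWHS

/-- `(i, a)` stands for the monomial `x ^ a • e_i` of the free module of rank `d` over the polynomial
ring in `n` variables. -/
abbrev ModMon (n d : ℕ) := Fin d × (Fin n →₀ ℕ)

/-- The product of the monomial `x ^ c` and the module monomial `s`. -/
noncomputable def ModMon.shift {n d : ℕ} (c : Fin n →₀ ℕ) (s : ModMon n d) : ModMon n d := (s.1, c + s.2)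

/-- Admissible module orders: linear orders on the module monomials that are preserved under
multiplication by monomials and for which `e_i` is the smallest multiple of `e_i`. -/
structure ModuleOrder (n d : ℕ) where
  le : ModMon n d → ModMon n d → Prop
  le_total : ∀ s t, le s t ∨ le t s
  le_antisymm : ∀ s t, le s t → le t s → s = t
  le_trans : ∀ s t v, le s t → le t v → le s v
  unit_le : ∀ (i : Fin d) (a : Fin n →₀ ℕ), le (i, 0) (i, a)
  shift_le : ∀ (c : Fin n →₀ ℕ) (s t : ModMon n d), le s t → le (s.shift c) (t.shift c)

/-- The strict part of a module order. -/
def ModuleOrder.lt {n d : ℕ} (so : ModuleOrder n d) (s t : ModMon n d) : Prop :=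
  so.le s t ∧ s ≠ t

/-- A monomial order and a module order are compatible if `σ e_j ≤ τ e_j ↔ σ ≤ τ`. -/
def Compatible {n d : ℕ} (mo : MonomialOrder (Fin n)) (so : ModuleOrder n d) : Prop :=
  ∀ (j : Fin d) (a b : Fin n →₀ ℕ), so.le (j, a) (j, b) ↔ mo.toSyn a ≤ mo.toSyn b

/-- Pairs `(u, p)` of a vector of polynomials and a polynomial. -/
abbrev SigPoly (k : Type*) [Field k] (n d : ℕ) :=
  (Fin d → MvPolynomial (Fin n) k) × MvPolynomial (Fin n) k

section

variable {k : Type*} [Field k] {n d : ℕ} (mo : MonomialOrder (Fin n)) (so : ModuleOrder n d)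

/-- `s` is the leading module monomial of the first component of `c` (so that component is not
zero). -/
def IsSig (c : SigPoly k n d) (s : ModMon n d) : Prop :=
  (c.1 s.1).coeff s.2 ≠ 0 ∧ ∀ t : ModMon n d, (c.1 t.1).coeff t.2 ≠ 0 → so.le t s

/-- `c` is ts-rewritable by the set `B`. The zero pair has no signature and rewrites nothing. -/
def TsRewritable (B : Set (SigPoly k n d)) (c : SigPoly k n d) : Prop :=
  c.2 ≠ 0 ∧ ∃ b ∈ B, ∃ (a : Fin n →₀ ℕ) (s t : ModMon n d),
    IsSig so c s ∧ IsSig so b t ∧ t.shift a = s ∧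
      (b.2 = 0 ∨ mo.toSyn (a + mo.degree b.2) < mo.toSyn (mo.degree c.2))

/-- `c'` is the result of one tm-reduction of `c` by an element of `B`. -/
def TmReduces (B : Set (SigPoly k n d)) (c c' : SigPoly k n d) : Prop :=
  c.2 ≠ 0 ∧ ∃ b ∈ B, b.2 ≠ 0 ∧ ∃ (a : Fin n →₀ ℕ) (s t : ModMon n d),
    IsSig so c s ∧ IsSig so b t ∧ a + mo.degree b.2 = mo.degree c.2 ∧ so.lt (t.shift a) s ∧
      c' = c - MvPolynomial.monomial a (mo.leadingCoeff c.2 / mo.leadingCoeff b.2) • b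

/-- `c` is the J-pair of `p` and `q`, with `p` as its first component. -/
def IsJPairOf (p q c : SigPoly k n d) : Prop :=
  p.2 ≠ 0 ∧ q.2 ≠ 0 ∧ ∃ s t : ModMon n d, IsSig so p s ∧ IsSig so q t ∧
    so.lt (t.shift ((mo.degree p.2 ⊔ mo.degree q.2) - mo.degree q.2))
      (s.shift ((mo.degree p.2 ⊔ mo.degree q.2) - mo.degree p.2)) ∧
    c = MvPolynomial.monomial ((mo.degree p.2 ⊔ mo.degree q.2) - mo.degree p.2) (1 : k) • p

/-- The J-pairs of `sp` with the non-syzygy elements of `SG`. -/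
def jPairs (SG : Set (SigPoly k n d)) (sp : SigPoly k n d) : Set (SigPoly k n d) :=
  {c | ∃ q ∈ SG, q.2 ≠ 0 ∧ (IsJPairOf mo so sp q c ∨ IsJPairOf mo so q sp c)}

/-- The principal syzygies of `sp` with the non-syzygy elements of `SG`. -/
def principalSyzygies (SG : Set (SigPoly k n d)) (sp : SigPoly k n d) : Set (SigPoly k n d) :=
  {c | ∃ q ∈ SG, q.2 ≠ 0 ∧ c = (sp.2 • q.1 - q.2 • sp.1, 0)}

/-- `C'` arises from `C` by storing, for each distinct signature, only one pair among those of
minimal leading monomial. -/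
def IsPruning (C C' : Set (SigPoly k n d)) : Prop :=
  C' ⊆ C ∧
  (∀ c ∈ C', ∀ c' ∈ C', ∀ s, IsSig so c s → IsSig so c' s → c = c') ∧
  ∀ c ∈ C, ∀ s, IsSig so c s →
    ∃ c' ∈ C', IsSig so c' s ∧ mo.toSyn (mo.degree c'.2) ≤ mo.toSyn (mo.degree c.2)

/-- `c` is an element of `C` with minimal signature. -/
def IsMinPair (C : Set (SigPoly k n d)) (c : SigPoly k n d) : Prop :=
  c ∈ C ∧ ∀ c' ∈ C, ∀ s s', IsSig so c s → IsSig so c' s' → so.le s s'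

/-- One step of interreduction: a term of one polynomial that is divisible by the leading monomial of
another one is cancelled, or a zero polynomial is dropped. -/
inductive InterreduceStep :
    Multiset (MvPolynomial (Fin n) k) → Multiset (MvPolynomial (Fin n) k) → Prop
  | reduce (f h : MvPolynomial (Fin n) k) (S : Multiset (MvPolynomial (Fin n) k))
      (a : Fin n →₀ ℕ) (hS : h ∈ S) (h0 : h ≠ 0) (ha : f.coeff a ≠ 0) (hd : mo.degree h ≤ a) :
      InterreduceStep (f ::ₘ S)
        ((f - MvPolynomial.monomial (a - mo.degree h) (f.coeff a / mo.leadingCoeff h) * h) ::ₘ S)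
  | drop (S : Multiset (MvPolynomial (Fin n) k)) : InterreduceStep (0 ::ₘ S) S

/-- The pairs `(e_i, f_i)` for the list `L = [f_1, f_2, …]`. -/
def initPairs (d : ℕ) (L : List (MvPolynomial (Fin n) k)) : Set (SigPoly k n d) :=
  {c | ∃ (i : Fin d) (hi : (i : ℕ) < L.length), c = (Pi.single i 1, L[(i : ℕ)])}

/-- The pairs `(f_i e_j - f_j e_i, 0)`, `i < j`, for the list `L = [f_1, f_2, …]`. -/
def initSyzygies (d : ℕ) (L : List (MvPolynomial (Fin n) k)) : Set (SigPoly k n d) :=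
  {c | ∃ (i j : Fin d) (hi : (i : ℕ) < L.length) (hj : (j : ℕ) < L.length), i < j ∧
    c = (Pi.single j L[(i : ℕ)] - Pi.single i L[(j : ℕ)], 0)}

end

/-- The states of the algorithm: interreducing the input; at the head of the while-loop with pair set
`CPs` and basis `SG`; tm-reducing the selected pair `cp`; finished with output `G`. -/
inductive State (k : Type*) [Field k] (n d : ℕ)
  | interreducing (S : Multiset (MvPolynomial (Fin n) k))
  | loop (CPs SG : Set (SigPoly k n d))
  | reducing (CPs SG : Set (SigPoly k n d)) (cp : SigPoly k n d)
  | finished (G : Set (MvPolynomial (Fin n) k))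

/-- The initial state on the input `f_1, …, f_d`. -/
def start {k : Type*} [Field k] {n d : ℕ} (f : Fin d → MvPolynomial (Fin n) k) : State k n d :=
  .interreducing (Finset.univ.val.map f)

/-- The elementary steps of the GVWHS algorithm. Every choice that the algorithm leaves open (the
order of the interreductions and tm-reductions, ties) is left open here. -/
inductive Step {k : Type*} [Field k] {n d : ℕ} (mo : MonomialOrder (Fin n))
    (so : ModuleOrder n d) : State k n d → State k n d → Prop
  | interreduce (S S' : Multiset (MvPolynomial (Fin n) k)) (h : InterreduceStep mo S S') :
      Step mo so (.interreducing S) (.interreducing S')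
  | init (S : Multiset (MvPolynomial (Fin n) k)) (L : List (MvPolynomial (Fin n) k))
      (hS : ∀ S', ¬ InterreduceStep mo S S') (hL : (L : Multiset (MvPolynomial (Fin n) k)) = S)
      (hsort : L.Pairwise fun f g => mo.toSyn (mo.degree f) ≤ mo.toSyn (mo.degree g)) :
      Step mo so (.interreducing S) (.loop (initPairs d L) (initSyzygies d L))
  | discard (CPs SG : Set (SigPoly k n d)) (cp : SigPoly k n d)
      (hmin : IsMinPair so CPs cp) (hr : TsRewritable mo so SG cp) :
      Step mo so (.loop CPs SG) (.loop (CPs \ {cp}) SG)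
  | select (CPs SG : Set (SigPoly k n d)) (cp : SigPoly k n d)
      (hmin : IsMinPair so CPs cp) (hr : ¬ TsRewritable mo so SG cp) :
      Step mo so (.loop CPs SG) (.reducing (CPs \ {cp}) SG cp)
  | tmReduce (CPs SG : Set (SigPoly k n d)) (cp cp' : SigPoly k n d)
      (h : TmReduces mo so SG cp cp') :
      Step mo so (.reducing CPs SG cp) (.reducing CPs SG cp')
  | storeNonzero (CPs CPs' SG : Set (SigPoly k n d)) (sp : SigPoly k n d)
      (hirr : ∀ c, ¬ TmReduces mo so SG sp c) (h0 : sp.2 ≠ 0)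
      (hprune : IsPruning mo so (CPs ∪ jPairs mo so SG sp) CPs') :
      Step mo so (.reducing CPs SG sp) (.loop CPs' (SG ∪ principalSyzygies SG sp ∪ {sp}))
  | storeZero (CPs SG : Set (SigPoly k n d)) (sp : SigPoly k n d) (h0 : sp.2 = 0) :
      Step mo so (.reducing CPs SG sp) (.loop CPs (SG ∪ {sp}))
  | finish (SG : Set (SigPoly k n d)) :
      Step mo so (.loop ∅ SG) (.finished {g | g ≠ 0 ∧ ∃ u, (u, g) ∈ SG})

/-- `G` is a Gröbner basis of the ideal `I`. -/
def IsGroebnerBasis {k : Type*} [Field k] {n : ℕ} (mo : MonomialOrder (Fin n))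
    (I : Ideal (MvPolynomial (Fin n) k)) (G : Set (MvPolynomial (Fin n) k)) : Prop :=
  G.Finite ∧ G ⊆ (I : Set (MvPolynomial (Fin n) k)) ∧
    ∀ p ∈ I, p ≠ 0 → ∃ g ∈ G, g ≠ 0 ∧ mo.degree g ≤ mo.degree p

end GVWHS

/-! Correctness rests on a cover criterion: if `SG` rewrites all its J-pairs and contains every unit
signature whose generator is nonzero, then it is a Gröbner basis. Among the multiples of elements of
`SG` with a given signature, either one is a syzygy, or one of least leading monomial cannot be
cancelled at a smaller signature: the J-pair behind such a cancellation would be rewritable and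
yield a syzygy or a smaller multiple (`exists_irreducible_of_isSig`). Cancelling signatures against
these multiples and inducting on the signature gives `isLeadAt_of_isSig`.

The loop preserves (`LoopInv`) that each J-pair of `SG` is rewritable or represented in `CPs` by a
pair of equal signature and no larger leading monomial. Stored non-syzygies have signatures below
all pending ones, and a pending pair is initial or tm-reducible; hence the result of processing a
pair rewrites every J-pair which that pair represented.

Termination is Dickson's lemma for the keys (signature, leading monomial) of stored non-syzygies: if
an old key divided a new one, the new element would be tm-reducible or the selected pair rewritable
(`ReduceInv.properlyExtends`). Between two such stores, the number of pairs and the leading monomial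
under reduction decrease. Interreduction terminates by the multiset order on exponents. -/

namespace GVWHS

open MvPolynomial

/-! ### Admissible module orders -/

section ModuleOrder

variable {n d : ℕ} {so : ModuleOrder n d} {s t v : ModMon n d}

lemma ModMon.shift_zero (s : ModMon n d) : s.shift 0 = s := by
  simp [ModMon.shift]

lemma ModMon.shift_shift (a b : Fin n →₀ ℕ) (s : ModMon n d) :
    (s.shift a).shift b = s.shift (b + a) := by
  simp [ModMon.shift, add_assoc]

lemma ModMon.shift_injective (c : Fin n →₀ ℕ) :
    Function.Injective (ModMon.shift c : ModMon n d → ModMon n d) := by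
  rintro ⟨i, a⟩ ⟨j, b⟩ h
  simpa [ModMon.shift] using h

lemma ModMon.shift_eq_unit {i : Fin d} {a : Fin n →₀ ℕ} (h : s.shift a = (i, 0)) :
    a = 0 ∧ s = (i, 0) := by
  obtain ⟨j, b⟩ := s
  simp only [ModMon.shift, Prod.mk.injEq, add_eq_zero] at h
  obtain ⟨rfl, rfl, rfl⟩ := h
  exact ⟨rfl, rfl⟩

lemma ModuleOrder.le_refl (so : ModuleOrder n d) (s : ModMon n d) : so.le s s :=
  (so.le_total s s).elim id id

lemma ModuleOrder.lt_irrefl (so : ModuleOrder n d) (s : ModMon n d) : ¬ so.lt s s :=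
  fun h => h.2 rfl

lemma ModuleOrder.lt_of_not_le (h : ¬ so.le s t) : so.lt t s :=
  ⟨(so.le_total s t).resolve_left h, fun e => h (e ▸ so.le_refl _)⟩

lemma ModuleOrder.lt.not_le (h : so.lt s t) : ¬ so.le t s :=
  fun h' => h.2 (so.le_antisymm _ _ h.1 h')

lemma ModuleOrder.lt_of_lt_of_le (h : so.lt s t) (h' : so.le t v) : so.lt s v :=
  so.lt_of_not_le fun hv => h.not_le (so.le_trans _ _ _ h' hv)

lemma ModuleOrder.lt_of_le_of_lt (h : so.le s t) (h' : so.lt t v) : so.lt s v :=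
  so.lt_of_not_le fun hv => h'.not_le (so.le_trans _ _ _ hv h)

lemma ModuleOrder.le_shift (so : ModuleOrder n d) (c : Fin n →₀ ℕ) (s : ModMon n d) :
    so.le s (s.shift c) := by
  have := so.shift_le s.2 _ _ (so.unit_le s.1 c)
  simpa [ModMon.shift, add_comm] using this

lemma ModuleOrder.lt.shift (h : so.lt s t) (c : Fin n →₀ ℕ) :
    so.lt (s.shift c) (t.shift c) :=
  ⟨so.shift_le c _ _ h.1, fun e => h.2 (ModMon.shift_injective c e)⟩

lemma ModuleOrder.lt_of_shift_lt (c : Fin n →₀ ℕ) (h : so.lt (s.shift c) (t.shift c)) :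
    so.lt s t :=
  so.lt_of_not_le fun h' => h.not_le (so.shift_le c _ _ h')

lemma wellQuasiOrdered_modMon (n d : ℕ) :
    WellQuasiOrdered fun s t : ModMon n d => s.1 = t.1 ∧ s.2 ≤ t.2 :=
  WellQuasiOrdered.prod (Finite.wellQuasiOrdered (· = ·)) wellQuasiOrdered_le

/-- By Dickson's lemma a descending chain would contain a later multiple of an earlier term, and
multiples are never smaller. -/
lemma ModuleOrder.wellFounded_lt (so : ModuleOrder n d) : WellFounded so.lt := by
  rw [wellFounded_iff_isEmpty_descending_chain]
  refine ⟨fun ⟨f, hf⟩ => ?_⟩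
  obtain ⟨i, j, hij, h1, h2⟩ := wellQuasiOrdered_modMon n d f
  have hle : so.le (f i) (f j) := by
    have : f j = (f i).shift ((f j).2 - (f i).2) := by
      ext1
      · exact h1.symm
      · simp [ModMon.shift, tsub_add_cancel_of_le h2]
    rw [this]
    exact so.le_shift _ _
  have hlt : ∀ m, so.lt (f (i + m + 1)) (f i) := by
    intro m
    induction m with
    | zero => exact hf i
    | succ m ih => exact so.lt_of_lt_of_le (hf (i + m + 1)) ih.1
  obtain ⟨m, rfl⟩ := Nat.exists_eq_add_of_lt hij
  exact (hlt m).not_le hle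

end ModuleOrder

/-! ### Leading terms -/

section Degree

variable {k : Type*} [Field k] {n : ℕ} {mo : MonomialOrder (Fin n)}
  {p q : MvPolynomial (Fin n) k}

lemma degree_monomial_mul {r : k} (hr : r ≠ 0) (hq : q ≠ 0) (a : Fin n →₀ ℕ) :
    mo.degree (monomial a r * q) = a + mo.degree q := by
  classical
  rw [mo.degree_mul (by simpa using hr) hq, mo.degree_monomial, if_neg hr]

lemma leadingCoeff_monomial_mul {r : k} (a : Fin n →₀ ℕ) :
    mo.leadingCoeff (monomial a r * q) = r * mo.leadingCoeff q := by
  rw [mo.leadingCoeff_mul, mo.leadingCoeff_monomial]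

/-- Subtracting a polynomial with the same leading term lowers the leading monomial. -/
lemma sub_eq_zero_or_degree_sub_lt (hd : mo.degree q = mo.degree p)
    (hc : mo.leadingCoeff q = mo.leadingCoeff p) :
    p - q = 0 ∨ mo.toSyn (mo.degree (p - q)) < mo.toSyn (mo.degree p) := by
  refine or_iff_not_imp_left.2 fun h0 => lt_of_le_of_ne ?_ fun he => ?_
  · simpa [hd] using mo.degree_sub_le (f := p) (g := q)
  · have he' := mo.toSyn.injective he
    apply mo.coeff_degree_ne_zero_iff.2 h0
    rw [he', coeff_sub, sub_eq_zero]
    unfold MonomialOrder.leadingCoeff at hc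
    rw [← hc, hd]

end Degree

/-! ### Signatures and values of pairs -/

section Signature

variable {k : Type*} [Field k] {n d : ℕ} {mo : MonomialOrder (Fin n)} {so : ModuleOrder n d}
  {b c : SigPoly k n d} {s t : ModMon n d}

lemma IsSig.unique (h : IsSig so c s) (h' : IsSig so c t) : s = t :=
  so.le_antisymm _ _ (h'.2 _ h.1) (h.2 _ h'.1)

lemma exists_isSig (h : c.1 ≠ 0) : ∃ s, IsSig so c s := by
  classical
  let T : Finset (ModMon n d) :=
    Finset.univ.biUnion fun i => (c.1 i).support.image fun a => (i, a)
  have hT : ∀ t : ModMon n d, t ∈ T ↔ (c.1 t.1).coeff t.2 ≠ 0 := by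
    rintro ⟨i, a⟩
    simp [T]
  have key : ∀ U : Finset (ModMon n d), U.Nonempty → ∃ s ∈ U, ∀ t ∈ U, so.le t s := by
    intro U hU
    induction hU using Finset.Nonempty.cons_induction with
    | singleton a => exact ⟨a, by simp, by simpa using so.le_refl a⟩
    | cons a U ha hU ih =>
      obtain ⟨s, hs, hmax⟩ := ih
      rcases so.le_total a s with h | h
      · exact ⟨s, by simp [hs], by simpa [h] using fun i b => hmax (i, b)⟩
      · exact ⟨a, by simp, by
          simpa [so.le_refl] using fun i b hb => so.le_trans _ _ _ (hmax (i, b) hb) h⟩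
  have hne : T.Nonempty := by
    obtain ⟨i, hi⟩ := Function.ne_iff.1 h
    obtain ⟨a, ha⟩ := MvPolynomial.ne_zero_iff.1 hi
    exact ⟨(i, a), (hT _).2 ha⟩
  obtain ⟨s, hs, hmax⟩ := key T hne
  exact ⟨s, (hT _).1 hs, fun t ht => hmax t ((hT _).2 ht)⟩

lemma coeff_monomial_smul_shift (a : Fin n →₀ ℕ) (r : k) (c : SigPoly k n d) (t : ModMon n d) :
    (((monomial a r : MvPolynomial (Fin n) k) • c).1 (t.shift a).1).coeff (t.shift a).2 =
      r * (c.1 t.1).coeff t.2 := by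
  simp [ModMon.shift, coeff_monomial_mul]

lemma IsSig.monomial_smul (h : IsSig so c s) {r : k} (hr : r ≠ 0) (a : Fin n →₀ ℕ) :
    IsSig so ((monomial a r : MvPolynomial (Fin n) k) • c) (s.shift a) := by
  refine ⟨?_, fun t ht => ?_⟩
  · rw [coeff_monomial_smul_shift]
    exact mul_ne_zero hr h.1
  · have hle : a ≤ t.2 := by
      by_contra hle
      simp [coeff_monomial_mul', hle] at ht
    have ht' : t = ModMon.shift a (t.1, t.2 - a) := by
      simp [ModMon.shift, add_tsub_cancel_of_le hle]
    rw [ht', coeff_monomial_smul_shift] at ht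
    rw [ht']
    exact so.shift_le a _ _ (h.2 _ (right_ne_zero_of_mul ht))

lemma IsSig.sub_of_lt (hc : IsSig so c s) (hb : IsSig so b t) (hlt : so.lt t s) :
    IsSig so (c - b) s := by
  have hbs : (b.1 s.1).coeff s.2 = 0 := by
    by_contra h
    exact hlt.not_le (hb.2 _ h)
  refine ⟨by simpa [hbs] using hc.1, fun v hv => ?_⟩
  by_cases hcv : (c.1 v.1).coeff v.2 = 0
  · refine so.le_trans _ _ _ (hb.2 v fun h => hv ?_) hlt.1
    simp [hcv, h]
  · exact hc.2 v hcv

/-- The top coefficients cancel; this drop drives the induction on signatures. -/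
lemma IsSig.lt_of_sub (hc : IsSig so c s) (hb : IsSig so b s)
    (he : (b.1 s.1).coeff s.2 = (c.1 s.1).coeff s.2) (h : IsSig so (c - b) t) : so.lt t s := by
  refine ⟨?_, ?_⟩
  · by_cases hct : (c.1 t.1).coeff t.2 = 0
    · exact hb.2 t fun h' => h.1 (by simp [hct, h'])
    · exact hc.2 t hct
  · rintro rfl
    exact h.1 (by simp [he])

lemma isSig_single (i : Fin d) (p : MvPolynomial (Fin n) k) :
    IsSig so (Pi.single i 1, p) (i, 0) := by
  classical
  refine ⟨by simp, fun t ht => ?_⟩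
  obtain ⟨j, a⟩ := t
  rcases eq_or_ne j i with rfl | hj
  · have : a = 0 := by
      by_contra ha
      simp [coeff_one, Ne.symm ha] at ht
    subst this
    exact so.le_refl _
  · simp [Pi.single_eq_of_ne hj] at ht

/-- The second component of `c` is the value of the first one at `F`. -/
def IsValue (F : Fin d → MvPolynomial (Fin n) k) (c : SigPoly k n d) : Prop :=
  c.2 = ∑ i, c.1 i * F i

variable {F : Fin d → MvPolynomial (Fin n) k}

lemma IsValue.sub (hc : IsValue F c) (hb : IsValue F b) : IsValue F (c - b) := by
  unfold IsValue at *
  simp [hc, hb, sub_mul]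

lemma IsValue.smul (hc : IsValue F c) (p : MvPolynomial (Fin n) k) : IsValue F (p • c) := by
  unfold IsValue at *
  simp [hc, Finset.mul_sum, mul_assoc]

lemma isValue_single (i : Fin d) : IsValue F (Pi.single i 1, F i) := by
  classical
  simp [IsValue, Pi.single_apply]

lemma IsValue.mem_span (hc : IsValue F c) : c.2 ∈ Ideal.span (Set.range F) := by
  rw [hc]
  exact Ideal.sum_mem _ fun i _ => Ideal.mul_mem_left _ _ (Ideal.subset_span ⟨i, rfl⟩)

end Signature

end GVWHS

namespace GVWHS

open MvPolynomial

variable {k : Type*} [Field k] {n d : ℕ} {mo : MonomialOrder (Fin n)} {so : ModuleOrder n d}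
  {F : Fin d → MvPolynomial (Fin n) k} {B SG : Set (SigPoly k n d)}
  {b c c' p q : SigPoly k n d} {s t : ModMon n d}

lemma IsValue.exists_isSig (hc : IsValue F c) (h0 : c.2 ≠ 0) : ∃ s, IsSig so c s := by
  refine GVWHS.exists_isSig fun h => h0 ?_
  rw [hc]
  simp [h]

/-! ### Rewriting and tm-reduction -/

section Reduction

lemma TsRewritable.mono (h : TsRewritable mo so B c) (hB : B ⊆ SG) : TsRewritable mo so SG c := by
  obtain ⟨h0, b, hb, h⟩ := h
  exact ⟨h0, b, hB hb, h⟩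

/-- A pair with the same signature and no smaller leading monomial inherits rewritability. -/
lemma TsRewritable.of_degree_le (h : TsRewritable mo so B c) (hs : IsSig so c s)
    (hs' : IsSig so c' s) (h0 : c'.2 ≠ 0)
    (hle : mo.toSyn (mo.degree c.2) ≤ mo.toSyn (mo.degree c'.2)) : TsRewritable mo so B c' := by
  obtain ⟨-, b, hb, a, s', t, hcs, hbt, hst, hd⟩ := h
  exact ⟨h0, b, hb, a, s, t, hs', hbt, hst.trans (hcs.unique hs), hd.imp_right (·.trans_le hle)⟩

lemma exists_tmReduces (h0 : c.2 ≠ 0) (hb : b ∈ B) (hb0 : b.2 ≠ 0) {a : Fin n →₀ ℕ}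
    (hs : IsSig so c s) (ht : IsSig so b t) (hd : a + mo.degree b.2 = mo.degree c.2)
    (hlt : so.lt (t.shift a) s) : ∃ c', TmReduces mo so B c c' :=
  ⟨_, h0, b, hb, hb0, a, s, t, hs, ht, hd, hlt, rfl⟩

lemma exists_tmReduces_mono (h : ∃ c', TmReduces mo so B c c') (hB : B ⊆ SG) :
    ∃ c', TmReduces mo so SG c c' := by
  obtain ⟨c', h0, b, hb, h⟩ := h
  exact ⟨c', h0, b, hB hb, h⟩

lemma TmReduces.isSig (h : TmReduces mo so B c c') (hs : IsSig so c s) : IsSig so c' s := by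
  obtain ⟨h0, b, hb, hb0, a, s', t, hs', ht, hd, hlt, rfl⟩ := h
  obtain rfl := hs.unique hs'
  refine hs.sub_of_lt (ht.monomial_smul ?_ a) hlt
  exact div_ne_zero (mo.leadingCoeff_ne_zero_iff.2 h0) (mo.leadingCoeff_ne_zero_iff.2 hb0)

lemma TmReduces.isValue (h : TmReduces mo so B c c') (hB : ∀ b ∈ B, IsValue F b)
    (hc : IsValue F c) : IsValue F c' := by
  obtain ⟨h0, b, hb, hb0, a, s', t, hs', ht, hd, hlt, rfl⟩ := h
  exact hc.sub ((hB b hb).smul _)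

lemma TmReduces.eq_zero_or_degree_lt (h : TmReduces mo so B c c') :
    c'.2 = 0 ∨ mo.toSyn (mo.degree c'.2) < mo.toSyn (mo.degree c.2) := by
  obtain ⟨h0, b, hb, hb0, a, s', t, hs', ht, hd, hlt, rfl⟩ := h
  have hb' := mo.leadingCoeff_ne_zero_iff.2 hb0
  have hr : mo.leadingCoeff c.2 / mo.leadingCoeff b.2 ≠ 0 :=
    div_ne_zero (mo.leadingCoeff_ne_zero_iff.2 h0) hb'
  refine sub_eq_zero_or_degree_sub_lt ?_ ?_
  · simpa only [Prod.smul_snd, smul_eq_mul, degree_monomial_mul hr hb0] using hd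
  · simp only [Prod.smul_snd, smul_eq_mul, leadingCoeff_monomial_mul]
    field_simp

end Reduction

/-! ### J-pairs -/

section JPair

lemma IsJPairOf.degree_eq (h : IsJPairOf mo so p q c) :
    mo.degree c.2 = mo.degree p.2 ⊔ mo.degree q.2 := by
  obtain ⟨hp, hq, s, t, hs, ht, hlt, rfl⟩ := h
  simp only [Prod.smul_snd, smul_eq_mul, degree_monomial_mul one_ne_zero hp]
  exact tsub_add_cancel_of_le le_sup_left

lemma IsJPairOf.snd_ne_zero (h : IsJPairOf mo so p q c) : c.2 ≠ 0 := by
  obtain ⟨hp, hq, s, t, hs, ht, hlt, rfl⟩ := h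
  exact mul_ne_zero (by simp) hp

lemma IsJPairOf.isSig (h : IsJPairOf mo so p q c) (hs : IsSig so p s) :
    IsSig so c (s.shift ((mo.degree p.2 ⊔ mo.degree q.2) - mo.degree p.2)) := by
  obtain ⟨hp, hq, s', t, hs', ht, hlt, rfl⟩ := h
  exact hs.monomial_smul one_ne_zero _

lemma IsJPairOf.isValue (h : IsJPairOf mo so p q c) (hp : IsValue F p) : IsValue F c := by
  obtain ⟨-, hq, s', t, hs', ht, hlt, rfl⟩ := h
  exact hp.smul _

/-- A J-pair is tm-reducible by the pair with the smaller multiplied signature. -/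
lemma IsJPairOf.exists_tmReduces (h : IsJPairOf mo so p q c) (hq : q ∈ B) :
    ∃ c', TmReduces mo so B c c' := by
  obtain ⟨hp, hq0, s, t, hs, ht, hlt, hc⟩ := id h
  refine GVWHS.exists_tmReduces h.snd_ne_zero hq hq0 (h.isSig hs) ht ?_ hlt
  rw [h.degree_eq]
  exact tsub_add_cancel_of_le le_sup_right

end JPair

/-! ### The cover criterion -/

section Groebner

/-- Some non-syzygy of `SG` has a multiple with leading monomial `m` and signature at most `s`. -/
def IsLeadAt (mo : MonomialOrder (Fin n)) (so : ModuleOrder n d) (SG : Set (SigPoly k n d))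
    (s : ModMon n d) (m : Fin n →₀ ℕ) : Prop :=
  ∃ b ∈ SG, b.2 ≠ 0 ∧ ∃ a t, IsSig so b t ∧ a + mo.degree b.2 = m ∧ so.le (t.shift a) s

lemma IsLeadAt.mono {m : Fin n →₀ ℕ} (h : IsLeadAt mo so SG s m) (hst : so.le s t) :
    IsLeadAt mo so SG t m := by
  obtain ⟨b, hb, hb0, a, v, hv, hd, hle⟩ := h
  exact ⟨b, hb, hb0, a, v, hv, hd, so.le_trans _ _ _ hle hst⟩

/-- If all J-pairs are rewritable, every signature is that of a syzygy or of a multiple of an element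
of `SG` whose leading monomial cannot be cancelled at a smaller signature. -/
lemma exists_irreducible_of_isSig (hval : ∀ b ∈ SG, IsValue F b)
    (hJ : ∀ p ∈ SG, ∀ q ∈ SG, ∀ c, IsJPairOf mo so p q c → TsRewritable mo so SG c)
    (hI : ∀ i, F i ≠ 0 → ∃ b ∈ SG, IsSig so b (i, 0)) (s : ModMon n d) :
    ∃ c, IsSig so c s ∧ IsValue F c ∧ (c.2 = 0 ∨ (c.2 ≠ 0 ∧ IsLeadAt mo so SG s (mo.degree c.2) ∧
      ∀ s', so.lt s' s → ¬ IsLeadAt mo so SG s' (mo.degree c.2))) := by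
  by_cases hF : F s.1 = 0
  · refine ⟨(monomial s.2 1 : MvPolynomial (Fin n) k) • (Pi.single s.1 1, F s.1), ?_,
      (isValue_single s.1).smul _, Or.inl (by simp [hF])⟩
    simpa [ModMon.shift] using (isSig_single (so := so) s.1 (F s.1)).monomial_smul one_ne_zero s.2
  let T : Set (SigPoly k n d × (Fin n →₀ ℕ)) :=
    {x | x.1 ∈ SG ∧ ∃ t, IsSig so x.1 t ∧ t.shift x.2 = s}
  have hne : T.Nonempty := by
    obtain ⟨b, hb, hs⟩ := hI _ hF
    exact ⟨(b, s.2), hb, _, hs, by simp [ModMon.shift]⟩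
  by_cases hz : ∃ x ∈ T, x.1.2 = 0
  · obtain ⟨⟨b, a⟩, ⟨hb, t, ht, rfl⟩, h0⟩ := hz
    exact ⟨_, ht.monomial_smul one_ne_zero a, (hval b hb).smul _, Or.inl (by simpa using h0)⟩
  push Not at hz
  -- Choose a multiple of signature `s` with least leading monomial.
  obtain ⟨⟨b, a⟩, hT, hmin⟩ := (InvImage.wf (fun x : SigPoly k n d × (Fin n →₀ ℕ) =>
    mo.toSyn (x.2 + mo.degree x.1.2)) wellFounded_lt).has_min T hne
  have hb0 := hz _ hT
  obtain ⟨hb, t, ht, rfl⟩ := hT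
  dsimp only at hb hb0 ht hmin ⊢
  have hd : mo.degree ((monomial a (1 : k) • b).2) = a + mo.degree b.2 :=
    degree_monomial_mul one_ne_zero hb0 a
  refine ⟨_, ht.monomial_smul one_ne_zero a, (hval b hb).smul _, Or.inr
    ⟨mul_ne_zero (by simp) hb0, ⟨b, hb, hb0, a, t, ht, hd.symm, so.le_refl _⟩, ?_⟩⟩
  rintro s' hs' ⟨q, hq, hq0, a', t', ht', hd', hle⟩
  have hlt : so.lt (t'.shift a') (t.shift a) := so.lt_of_le_of_lt hle hs'
  rw [hd] at hd'
  -- The lcm `M` divides the common leading monomial, with quotient `e`; so the two cancelling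
  -- multiples are `x ^ e` times the two sides of the J-pair of `b` and `q`.
  set M := mo.degree b.2 ⊔ mo.degree q.2 with hM
  have hMle : M ≤ a + mo.degree b.2 := sup_le le_add_self (hd' ▸ le_add_self)
  obtain ⟨e, he⟩ := exists_add_of_le hMle
  have ha : a = e + (M - mo.degree b.2) := by
    apply add_right_cancel (b := mo.degree b.2)
    rw [he, add_assoc, tsub_add_cancel_of_le le_sup_left, add_comm]
  have ha' : a' = e + (M - mo.degree q.2) := by
    apply add_right_cancel (b := mo.degree q.2)
    rw [hd', he, add_assoc, tsub_add_cancel_of_le le_sup_right, add_comm]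
  have hJlt : so.lt (t'.shift (M - mo.degree q.2)) (t.shift (M - mo.degree b.2)) := by
    apply so.lt_of_shift_lt e
    rwa [ModMon.shift_shift, ModMon.shift_shift, ← ha, ← ha']
  have hJp : IsJPairOf mo so b q _ := ⟨hb0, hq0, t, t', ht, ht', hJlt, rfl⟩
  obtain ⟨-, b', hb', a'', s₀, t₀, hs₀, ht₀, hst, hor⟩ := hJ b hb q hq _ hJp
  obtain rfl := hs₀.unique (hJp.isSig ht)
  -- Multiplied by `x ^ e`, the rewriter of the J-pair competes in `T`, against `hz` or minimality.
  have hT' : ((b', e + a'') : SigPoly k n d × (Fin n →₀ ℕ)) ∈ T := by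
    refine ⟨hb', t₀, ht₀, ?_⟩
    dsimp only
    rw [← ModMon.shift_shift, hst, ModMon.shift_shift, ← ha]
  rcases hor with hor | hor
  · exact hz _ hT' hor
  · apply hmin _ hT'
    rw [hJp.degree_eq] at hor
    change mo.toSyn (e + a'' + mo.degree b'.2) < mo.toSyn (a + mo.degree b.2)
    rw [he, add_assoc, add_comm _ e, map_add mo.toSyn e, map_add mo.toSyn e]
    exact add_lt_add_right hor _

/-- Subtract from `x` a scalar multiple `y` of the irreducible pair at `s`. The difference has
smaller signature, so induction applies to it, and the leading terms of `x - y` and `y` cannot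
cancel. -/
theorem isLeadAt_of_isSig (hval : ∀ b ∈ SG, IsValue F b)
    (hJ : ∀ p ∈ SG, ∀ q ∈ SG, ∀ c, IsJPairOf mo so p q c → TsRewritable mo so SG c)
    (hI : ∀ i, F i ≠ 0 → ∃ b ∈ SG, IsSig so b (i, 0)) (s : ModMon n d) :
    ∀ x : SigPoly k n d, IsSig so x s → IsValue F x → x.2 ≠ 0 →
      IsLeadAt mo so SG s (mo.degree x.2) := by
  induction s using so.wellFounded_lt.induction with
  | _ s ih =>
  intro x hxs hx hx0
  obtain ⟨c, hcs, hc, hor⟩ := exists_irreducible_of_isSig (mo := mo) hval hJ hI s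
  set r : k := (x.1 s.1).coeff s.2 / (c.1 s.1).coeff s.2 with hr
  have hr0 : r ≠ 0 := div_ne_zero hxs.1 hcs.1
  have hy : IsSig so ((monomial 0 r : MvPolynomial (Fin n) k) • c) s := by
    simpa only [ModMon.shift_zero] using hcs.monomial_smul hr0 0
  have hyc : (((monomial 0 r : MvPolynomial (Fin n) k) • c).1 s.1).coeff s.2 =
      (x.1 s.1).coeff s.2 := by
    have := coeff_monomial_smul_shift 0 r c s
    rw [ModMon.shift_zero] at this
    rw [this, hr, div_mul_cancel₀ _ hcs.1]
  have hyv : IsValue F ((monomial 0 r : MvPolynomial (Fin n) k) • c) := hc.smul _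
  have hyd : c.2 ≠ 0 → mo.degree ((monomial 0 r : MvPolynomial (Fin n) k) • c).2 =
      mo.degree c.2 := fun h => by
    simpa using degree_monomial_mul (mo := mo) hr0 h 0
  have hyz : c.2 = 0 → ((monomial 0 r : MvPolynomial (Fin n) k) • c).2 = 0 := fun h => by
    simp [h]
  generalize (monomial 0 r : MvPolynomial (Fin n) k) • c = y at hy hyc hyv hyd hyz
  have key : (x - y).2 ≠ 0 → ∃ t, so.lt t s ∧ IsLeadAt mo so SG t (mo.degree (x - y).2) := by
    intro h0
    obtain ⟨t, ht⟩ := (hx.sub hyv).exists_isSig (so := so) h0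
    have hlt := hxs.lt_of_sub hy hyc ht
    exact ⟨t, hlt, ih t hlt _ ht (hx.sub hyv) h0⟩
  have hsplit : x.2 = (x - y).2 + y.2 := by simp
  rcases hor with hc0 | ⟨hc0, hlead, hirr⟩
  · have hxy : (x - y).2 = x.2 := by simp [hyz hc0]
    rw [hxy] at key
    obtain ⟨t, hlt, h⟩ := key hx0
    exact h.mono hlt.1
  · rw [← hyd hc0] at hlead hirr
    by_cases h0 : (x - y).2 = 0
    · rw [hsplit, h0, zero_add]
      exact hlead
    obtain ⟨t, hlt, h⟩ := key h0
    rcases lt_trichotomy (mo.toSyn (mo.degree (x - y).2)) (mo.toSyn (mo.degree y.2)) with h' | h' | h'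
    · rw [hsplit, mo.degree_add_eq_right_of_lt h']
      exact hlead
    -- Equal leading monomials would put that of `y` at a signature below `s`.
    · rw [mo.toSyn.injective h'] at h
      exact absurd h (hirr t hlt)
    · rw [hsplit, mo.degree_add_of_lt h']
      exact h.mono hlt.1

theorem isGroebnerBasis_of_jPairs (hfin : SG.Finite) (hval : ∀ b ∈ SG, IsValue F b)
    (hJ : ∀ p ∈ SG, ∀ q ∈ SG, ∀ c, IsJPairOf mo so p q c → TsRewritable mo so SG c)
    (hI : ∀ i, F i ≠ 0 → ∃ b ∈ SG, IsSig so b (i, 0)) :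
    IsGroebnerBasis mo (Ideal.span (Set.range F)) {g | g ≠ 0 ∧ ∃ u, (u, g) ∈ SG} := by
  refine ⟨(hfin.image Prod.snd).subset ?_, ?_, fun p hp hp0 => ?_⟩
  · rintro g ⟨-, u, hu⟩
    exact ⟨_, hu, rfl⟩
  · rintro g ⟨-, u, hu⟩
    exact (hval _ hu).mem_span
  · obtain ⟨u, hu⟩ := Ideal.mem_span_range_iff_exists_fun.1 hp
    have hx : IsValue F (u, p) := hu.symm
    obtain ⟨s, hs⟩ := hx.exists_isSig (so := so) hp0
    obtain ⟨b, hb, hb0, a, t, -, hd, -⟩ := isLeadAt_of_isSig hval hJ hI s _ hs hx hp0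
    exact ⟨b.2, ⟨hb0, b.1, hb⟩, hb0, hd ▸ le_add_self⟩

end Groebner

end GVWHS

namespace GVWHS

open MvPolynomial Relation

/-! ### Termination of interreduction -/

section Interreduction

variable {k : Type*} [Field k] {n : ℕ} {mo : MonomialOrder (Fin n)}
  {S S' : Multiset (MvPolynomial (Fin n) k)}

/-- The exponents of all terms of the polynomials in `S`, with multiplicity. -/
noncomputable def allExponents (S : Multiset (MvPolynomial (Fin n) k)) : Multiset (Fin n →₀ ℕ) :=
  (S.map fun f => f.support.val).sum

/-- Deleting an element amounts to expanding it to nothing. -/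
lemma reflTransGen_cutExpand_of_le {α : Type*} {r : α → α → Prop} {s t : Multiset α} (h : s ≤ t) :
    ReflTransGen (CutExpand r) s t := by
  obtain ⟨u, rfl⟩ := Multiset.le_iff_exists_add.1 h
  induction u using Multiset.induction with
  | empty => simpa using ReflTransGen.refl
  | cons a u ih =>
    refine (ih (Multiset.le_add_right _ _)).tail ⟨0, a, by simp, ?_⟩
    simp [← Multiset.singleton_add, add_comm, ← add_assoc]

/-- Cancelling the term at `a` changes only smaller terms: `a` is replaced by the smaller exponents
of `g`, and then superfluous exponents are deleted. -/
lemma transGen_cutExpand_support {f g : MvPolynomial (Fin n) k} {a : Fin n →₀ ℕ}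
    (ha : f.coeff a ≠ 0) (hga : g.coeff a = 0)
    (hg : ∀ b, mo.toSyn a < mo.toSyn b → g.coeff b = f.coeff b) :
    TransGen (CutExpand fun b c => mo.toSyn b < mo.toSyn c) g.support.val f.support.val := by
  classical
  let T := g.support.filter fun b => mo.toSyn b < mo.toSyn a
  refine TransGen.tail' (b := (f.support.erase a).val + T.val) ?_ ⟨T.val, a, ?_, ?_⟩
  · apply reflTransGen_cutExpand_of_le
    rw [Multiset.le_iff_subset g.support.nodup]
    intro b hb
    rw [Finset.mem_val, mem_support_iff] at hb
    rw [Multiset.mem_add, Finset.mem_val, Finset.mem_val, Finset.mem_erase, Finset.mem_filter,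
      mem_support_iff, mem_support_iff]
    rcases lt_trichotomy (mo.toSyn a) (mo.toSyn b) with h | h | h
    · exact Or.inl ⟨by rintro rfl; exact h.ne rfl, hg b h ▸ hb⟩
    · exact absurd (mo.toSyn.injective h ▸ hga) hb
    · exact Or.inr ⟨hb, h⟩
  · intro b hb
    exact (Finset.mem_filter.1 hb).2
  · rw [add_right_comm, Finset.erase_val, Multiset.add_singleton_eq_iff.2]
    refine ⟨?_, ?_⟩
    · simp [ha]
    · simp

lemma transGen_cutExpand_add_right {α : Type*} {r : α → α → Prop} {s t : Multiset α}
    (h : TransGen (CutExpand r) s t) (u : Multiset α) :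
    TransGen (CutExpand r) (s + u) (t + u) :=
  h.lift (· + u) fun _ _ => (cutExpand_add_right u).2

/-- The cardinality is a second component because dropping a zero leaves the exponents unchanged. -/
theorem wellFounded_interreduceStep (mo : MonomialOrder (Fin n)) :
    WellFounded fun S' S : Multiset (MvPolynomial (Fin n) k) => InterreduceStep mo S S' := by
  have hr : WellFounded fun b c : Fin n →₀ ℕ => mo.toSyn b < mo.toSyn c :=
    InvImage.wf mo.toSyn wellFounded_lt
  refine Subrelation.wf ?_ (InvImage.wf (fun S : Multiset (MvPolynomial (Fin n) k) =>
    (allExponents S, Multiset.card S)) (WellFounded.prod_lex hr.cutExpand.transGen wellFounded_lt))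
  rintro S' S (⟨f, h, S, a, hS, h0, ha, hd⟩ | _)
  · apply Prod.Lex.left
    simp only [allExponents, Multiset.map_cons, Multiset.sum_cons]
    apply transGen_cutExpand_add_right
    have hr : f.coeff a / mo.leadingCoeff h ≠ 0 :=
      div_ne_zero ha (mo.leadingCoeff_ne_zero_iff.2 h0)
    have hdeg : mo.degree (monomial (a - mo.degree h) (f.coeff a / mo.leadingCoeff h) * h) = a := by
      rw [degree_monomial_mul hr h0, tsub_add_cancel_of_le hd]
    refine transGen_cutExpand_support ha ?_ fun b hb => ?_
    · have hl := leadingCoeff_monomial_mul (mo := mo) (q := h) (r := f.coeff a / mo.leadingCoeff h)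
        (a - mo.degree h)
      rw [MonomialOrder.leadingCoeff, hdeg,
        div_mul_cancel₀ _ (mo.leadingCoeff_ne_zero_iff.2 h0)] at hl
      rw [coeff_sub, hl, sub_self]
    · rw [coeff_sub, mo.coeff_eq_zero_of_lt (f := monomial _ _ * h) (by rwa [hdeg]), sub_zero]
  · have : allExponents (0 ::ₘ S') = allExponents S' := by simp [allExponents]
    simp only [InvImage, this]
    exact Prod.Lex.right _ (by simp)

lemma InterreduceStep.card_le (h : InterreduceStep mo S S') :
    Multiset.card S' ≤ Multiset.card S := by
  cases h <;> simp

lemma InterreduceStep.span_eq (h : InterreduceStep mo S S') :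
    Ideal.span {f | f ∈ S'} = Ideal.span {f | f ∈ S} := by
  rcases h with ⟨f, h, S, a, hS, h0, ha, hd⟩ | _
  · apply le_antisymm <;> rw [Ideal.span_le] <;> intro g hg <;>
      rcases Multiset.mem_cons.1 hg with rfl | hg
    · exact Ideal.sub_mem _ (Ideal.subset_span (Multiset.mem_cons_self _ _))
        (Ideal.mul_mem_left _ _ (Ideal.subset_span (Multiset.mem_cons_of_mem hS)))
    · exact Ideal.subset_span (Multiset.mem_cons_of_mem hg)
    · have := Ideal.add_mem (Ideal.span {f | f ∈ (g - monomial (a - mo.degree h)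
          (g.coeff a / mo.leadingCoeff h) * h) ::ₘ S})
        (Ideal.subset_span (Multiset.mem_cons_self _ _))
        (Ideal.mul_mem_left _ (monomial (a - mo.degree h) (g.coeff a / mo.leadingCoeff h))
          (Ideal.subset_span (Multiset.mem_cons_of_mem hS)))
      rwa [sub_add_cancel] at this
    · exact Ideal.subset_span (Multiset.mem_cons_of_mem hg)
  · have : {f | f ∈ (0 ::ₘ S')} = insert 0 {f | f ∈ S'} := by
      ext f
      simp
    rw [this, Ideal.span_insert_zero]

end Interreduction

end GVWHS

/-! ### The loop invariant -/

namespace GVWHS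

open MvPolynomial

variable {k : Type*} [Field k] {n d : ℕ} {mo : MonomialOrder (Fin n)} {so : ModuleOrder n d}
  {F : Fin d → MvPolynomial (Fin n) k} {C C' CPs SG : Set (SigPoly k n d)}
  {b c cp sp p q : SigPoly k n d} {s t v : ModMon n d}

/-- The loop invariant of the algorithm for the interreduced input `F`. -/
structure LoopInv (mo : MonomialOrder (Fin n)) (so : ModuleOrder n d)
    (F : Fin d → MvPolynomial (Fin n) k) (CPs SG : Set (SigPoly k n d)) : Prop where
  finite_pairs : CPs.Finite
  finite_basis : SG.Finite
  value_pairs : ∀ c ∈ CPs, IsValue F c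
  value_basis : ∀ b ∈ SG, IsValue F b
  pair_ne_zero : ∀ c ∈ CPs, c.2 ≠ 0
  -- This forces the leading monomial to drop when a non-initial pair is processed.
  unit_or_tmReduces : ∀ c ∈ CPs, (∃ i, c = (Pi.single i 1, F i)) ∨ ∃ c', TmReduces mo so SG c c'
  sig_injective : ∀ c ∈ CPs, ∀ c' ∈ CPs, ∀ s, IsSig so c s → IsSig so c' s → c = c'
  sig_lt : ∀ b ∈ SG, b.2 ≠ 0 → ∀ c ∈ CPs, ∀ t s, IsSig so b t → IsSig so c s → so.lt t s
  jPair : ∀ p ∈ SG, ∀ q ∈ SG, ∀ c, IsJPairOf mo so p q c →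
    (∃ c' ∈ CPs, ∃ s, IsSig so c s ∧ IsSig so c' s ∧
      mo.toSyn (mo.degree c'.2) ≤ mo.toSyn (mo.degree c.2)) ∨ TsRewritable mo so SG c
  unit : ∀ i, F i ≠ 0 → ∃ b ∈ CPs ∪ SG, IsSig so b (i, 0)

/-- The invariant while the pair `cp` is being tm-reduced and has become `c`. -/
structure ReduceInv (mo : MonomialOrder (Fin n)) (so : ModuleOrder n d)
    (F : Fin d → MvPolynomial (Fin n) k) (CPs SG : Set (SigPoly k n d))
    (cp c : SigPoly k n d) : Prop where
  loopInv : LoopInv mo so F (insert cp CPs) SG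
  sig_lt : ∀ c' ∈ CPs, ∀ s s', IsSig so cp s → IsSig so c' s' → so.lt s s'
  not_tsRewritable : ¬ TsRewritable mo so SG cp
  value : IsValue F c
  isSig : ∀ s, IsSig so cp s → IsSig so c s
  eq_or_degree_lt : c.2 = 0 ∨ c = cp ∨ mo.toSyn (mo.degree c.2) < mo.toSyn (mo.degree cp.2)

lemma ReduceInv.exists_sig (h : ReduceInv mo so F CPs SG cp c) :
    ∃ s, IsSig so cp s ∧ IsSig so c s := by
  obtain ⟨s, hs⟩ := (h.loopInv.value_pairs cp (Set.mem_insert _ _)).exists_isSig (so := so)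
    (h.loopInv.pair_ne_zero cp (Set.mem_insert _ _))
  exact ⟨s, hs, h.isSig s hs⟩

/-- Rewritability passes from `cp` to the J-pairs it represented. -/
lemma LoopInv.discard (h : LoopInv mo so F CPs SG) (hr : TsRewritable mo so SG cp) :
    LoopInv mo so F (CPs \ {cp}) SG where
  finite_pairs := h.finite_pairs.sdiff
  finite_basis := h.finite_basis
  value_pairs c hc := h.value_pairs c hc.1
  value_basis := h.value_basis
  pair_ne_zero c hc := h.pair_ne_zero c hc.1
  unit_or_tmReduces c hc := h.unit_or_tmReduces c hc.1
  sig_injective c hc c' hc' := h.sig_injective c hc.1 c' hc'.1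
  sig_lt b hb hb0 c hc := h.sig_lt b hb hb0 c hc.1
  jPair p hp q hq c hc := by
    rcases h.jPair p hp q hq c hc with ⟨c', hc', s, hs, hs', hd⟩ | hts
    · by_cases he : c' = cp
      · subst he
        exact Or.inr (hr.of_degree_le hs' hs hc.snd_ne_zero hd)
      · exact Or.inl ⟨c', ⟨hc', he⟩, s, hs, hs', hd⟩
    · exact Or.inr hts
  unit i hi := by
    obtain ⟨b, hb, hs⟩ := h.unit i hi
    by_cases he : b = cp
    · subst he
      obtain ⟨-, b', hb', a, s', t, hs', ht, hst, -⟩ := hr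
      rw [← hs.unique hs'] at hst
      obtain ⟨-, rfl⟩ := ModMon.shift_eq_unit hst
      exact ⟨b', Or.inr hb', ht⟩
    · exact ⟨b, hb.imp_left fun hb => ⟨hb, he⟩, hs⟩

lemma LoopInv.select (h : LoopInv mo so F CPs SG) (hmin : IsMinPair so CPs cp)
    (hr : ¬ TsRewritable mo so SG cp) : ReduceInv mo so F (CPs \ {cp}) SG cp cp where
  loopInv := by rwa [Set.insert_sdiff_singleton, Set.insert_eq_of_mem hmin.1]
  sig_lt c' hc' s s' hs hs' := ⟨hmin.2 c' hc'.1 s s' hs hs', by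
    -- Minimality is strict since pending pairs have distinct signatures.
    rintro rfl
    exact hc'.2 (h.sig_injective _ hc'.1 _ hmin.1 s hs' hs)⟩
  not_tsRewritable := hr
  value := h.value_pairs cp hmin.1
  isSig _ := id
  eq_or_degree_lt := Or.inr (Or.inl rfl)

lemma ReduceInv.tmReduce {c' : SigPoly k n d} (h : ReduceInv mo so F CPs SG cp c)
    (hc : TmReduces mo so SG c c') : ReduceInv mo so F CPs SG cp c' where
  loopInv := h.loopInv
  sig_lt := h.sig_lt
  not_tsRewritable := h.not_tsRewritable
  value := hc.isValue h.loopInv.value_basis h.value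
  isSig s hs := hc.isSig (h.isSig s hs)
  eq_or_degree_lt := by
    refine hc.eq_zero_or_degree_lt.imp_right fun hlt => Or.inr ?_
    rcases h.eq_or_degree_lt with h' | rfl | h'
    · exact absurd h' hc.1
    · exact hlt
    · exact hlt.trans h'

/-- No signature of a non-syzygy of `SG` divides that of `cp` if `cp` is an initial pair. -/
lemma ReduceInv.not_unit (h : ReduceInv mo so F CPs SG cp c) (hb : b ∈ SG) (hb0 : b.2 ≠ 0)
    {a : Fin n →₀ ℕ} (ht : IsSig so b t) (hcp : IsSig so cp (t.shift a)) :
    ¬ ∃ i, cp = (Pi.single i 1, F i) := by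
  rintro ⟨i, rfl⟩
  obtain ⟨rfl, rfl⟩ := ModMon.shift_eq_unit (hcp.unique (isSig_single i (F i)))
  exact so.lt_irrefl _ (h.loopInv.sig_lt b hb hb0 _ (Set.mem_insert _ _) _ _ ht
    (isSig_single i (F i)))

/-- If a non-syzygy of `SG` has a signature dividing that of `cp`, the irreducible result `sp` is not
`cp` itself. -/
lemma ReduceInv.degree_lt (h : ReduceInv mo so F CPs SG cp sp)
    (hirr : ∀ c, ¬ TmReduces mo so SG sp c) (h0 : sp.2 ≠ 0) (hb : b ∈ SG) (hb0 : b.2 ≠ 0)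
    {a : Fin n →₀ ℕ} (ht : IsSig so b t) (hcp : IsSig so cp (t.shift a)) :
    mo.toSyn (mo.degree sp.2) < mo.toSyn (mo.degree cp.2) := by
  rcases h.eq_or_degree_lt with h' | rfl | h'
  · exact absurd h' h0
  · rcases h.loopInv.unit_or_tmReduces sp (Set.mem_insert _ _) with hu | ⟨c', hc'⟩
    · exact absurd hu (h.not_unit hb hb0 ht hcp)
    · exact absurd hc' (hirr c')
  · exact h'

/-- The signature of `p` divides that of `cp`, so `cp` is not initial; hence `sp` is a syzygy or has
smaller leading monomial than `cp`, and rewrites `c` with multiplier 1. -/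
lemma ReduceInv.tsRewritable_jPair (h : ReduceInv mo so F CPs SG cp sp)
    (hirr : sp.2 = 0 ∨ ∀ c, ¬ TmReduces mo so SG sp c) (hp : p ∈ SG)
    (hc : IsJPairOf mo so p q c) (hs : IsSig so c s) (hcp : IsSig so cp s)
    (hd : mo.toSyn (mo.degree cp.2) ≤ mo.toSyn (mo.degree c.2)) {B : Set (SigPoly k n d)}
    (hB : sp ∈ B) : TsRewritable mo so B c := by
  refine ⟨hc.snd_ne_zero, sp, hB, 0, s, s, hs, h.isSig s hcp, s.shift_zero, ?_⟩
  rw [zero_add]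
  by_cases h0 : sp.2 = 0
  · exact Or.inl h0
  · obtain ⟨hp0, -, t, -, ht, -⟩ := id hc
    refine Or.inr (lt_of_lt_of_le ?_ hd)
    exact h.degree_lt (hirr.resolve_left h0) h0 hp hp0 ht (hs.unique (hc.isSig ht) ▸ hcp)

lemma ReduceInv.storeZero (h : ReduceInv mo so F CPs SG cp sp) (h0 : sp.2 = 0) :
    LoopInv mo so F CPs (SG ∪ {sp}) where
  finite_pairs := h.loopInv.finite_pairs.subset (Set.subset_insert _ _)
  finite_basis := h.loopInv.finite_basis.union (Set.finite_singleton _)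
  value_pairs c hc := h.loopInv.value_pairs c (Or.inr hc)
  value_basis := by
    rintro b (hb | rfl)
    · exact h.loopInv.value_basis b hb
    · exact h.value
  pair_ne_zero c hc := h.loopInv.pair_ne_zero c (Or.inr hc)
  unit_or_tmReduces c hc := (h.loopInv.unit_or_tmReduces c (Or.inr hc)).imp_right
    fun h => exists_tmReduces_mono h Set.subset_union_left
  sig_injective c hc c' hc' := h.loopInv.sig_injective c (Or.inr hc) c' (Or.inr hc')
  sig_lt := by
    rintro b (hb | rfl) hb0 c hc
    · exact h.loopInv.sig_lt b hb hb0 c (Or.inr hc)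
    · exact absurd h0 hb0
  jPair := by
    rintro p (hp | rfl) q (hq | rfl) c hc
    · rcases h.loopInv.jPair p hp q hq c hc with ⟨c', rfl | hc', s, hs, hs', hd⟩ | hts
      · exact Or.inr (h.tsRewritable_jPair (Or.inl h0) hp hc hs hs' hd (Or.inr rfl))
      · exact Or.inl ⟨c', hc', s, hs, hs', hd⟩
      · exact Or.inr (hts.mono Set.subset_union_left)
    · exact absurd h0 hc.2.1
    · exact absurd h0 hc.1
    · exact absurd h0 hc.1
  unit i hi := by
    obtain ⟨b, (rfl | hb) | hb, hs⟩ := h.loopInv.unit i hi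
    · exact ⟨sp, Or.inr (Or.inr rfl), h.isSig _ hs⟩
    · exact ⟨b, Or.inl hb, hs⟩
    · exact ⟨b, Or.inr (Or.inl hb), hs⟩

/-- The J-pairs of an irreducible pair have larger signatures than the pair. -/
lemma sig_lt_of_mem_jPairs (hirr : ∀ c, ¬ TmReduces mo so SG sp c)
    (hs : IsSig so sp s) (hc : c ∈ jPairs mo so SG sp) (hv : IsSig so c v) : so.lt s v := by
  obtain ⟨q, hq, hq0, hJ | hJ⟩ := hc
  · rw [hv.unique (hJ.isSig hs)]
    refine ⟨so.le_shift _ _, fun he => ?_⟩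
    -- With multiplier 1 the J-pair would be `sp` itself, which `q` tm-reduces.
    have hz : (mo.degree sp.2 ⊔ mo.degree q.2) - mo.degree sp.2 = 0 := by
      have := congrArg Prod.snd he
      simpa [ModMon.shift] using this
    obtain ⟨c', hc'⟩ := hJ.exists_tmReduces hq
    obtain ⟨-, -, -, -, -, -, -, rfl⟩ := hJ
    rw [hz] at hc'
    refine hirr c' ?_
    convert hc' using 1
    exact (one_smul _ sp).symm
  · obtain ⟨-, -, t, s', ht, hs', hJlt, -⟩ := id hJ
    rw [hv.unique (hJ.isSig ht), hs.unique hs']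
    exact so.lt_of_le_of_lt (so.le_shift _ _) hJlt

lemma finite_jPairs (h : SG.Finite) (sp : SigPoly k n d) : (jPairs mo so SG sp).Finite := by
  let J (p q : SigPoly k n d) : SigPoly k n d :=
    monomial ((mo.degree p.2 ⊔ mo.degree q.2) - mo.degree p.2) (1 : k) • p
  refine ((h.image (J sp)).union (h.image (J · sp))).subset ?_
  rintro c ⟨q, hq, -, ⟨-, -, -, -, -, -, -, rfl⟩ | ⟨-, -, -, -, -, -, -, rfl⟩⟩
  · exact Or.inl ⟨q, hq, rfl⟩
  · exact Or.inr ⟨q, hq, rfl⟩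

lemma finite_principalSyzygies (h : SG.Finite) (sp : SigPoly k n d) :
    (principalSyzygies SG sp).Finite := by
  refine (h.image fun q => (sp.2 • q.1 - q.2 • sp.1, 0)).subset ?_
  rintro c ⟨q, hq, -, rfl⟩
  exact ⟨q, hq, rfl⟩

lemma isValue_principalSyzygy (hp : IsValue F p) (hq : IsValue F q) :
    IsValue F (p.2 • q.1 - q.2 • p.1, 0) := by
  have h := (hq.smul p.2).sub (hp.smul q.2)
  have h0 : (p.2 • q - q.2 • p).2 = 0 := by simp [mul_comm]
  unfold IsValue at h ⊢
  rwa [h0] at h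

/-- Old J-pairs represented by `cp` are now rewritten by `sp`; the others keep a representative
through pruning. J-pairs involving `sp` were just added, and have signatures above that of `sp`. -/
lemma ReduceInv.storeNonzero (h : ReduceInv mo so F CPs SG cp sp)
    (hirr : ∀ c, ¬ TmReduces mo so SG sp c) (h0 : sp.2 ≠ 0)
    (hprune : IsPruning mo so (CPs ∪ jPairs mo so SG sp) C) :
    LoopInv mo so F C (SG ∪ principalSyzygies SG sp ∪ {sp}) := by
  obtain ⟨hsub, hinj, hex⟩ := hprune
  obtain ⟨s, hcps, hsps⟩ := h.exists_sig
  have hSG : SG ⊆ SG ∪ principalSyzygies SG sp ∪ {sp} := fun x hx => Or.inl (Or.inl hx)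
  have hsp : sp ∈ SG ∪ principalSyzygies SG sp ∪ {sp} := Or.inr rfl
  have hlt : ∀ q ∈ SG, q.2 ≠ 0 → ∀ t, IsSig so q t → so.lt t s := fun q hq hq0 t ht =>
    h.loopInv.sig_lt q hq hq0 cp (Set.mem_insert _ _) t s ht hcps
  have hgt : ∀ c ∈ C, ∀ v, IsSig so c v → so.lt s v := by
    intro c hc v hv
    rcases hsub hc with hc | hc
    · exact h.sig_lt c hc s v hcps hv
    · exact sig_lt_of_mem_jPairs hirr hsps hc hv
  have hnew : ∀ c ∈ jPairs mo so SG sp, ∀ v, IsSig so c v → ∃ c' ∈ C, ∃ s, IsSig so c s ∧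
      IsSig so c' s ∧ mo.toSyn (mo.degree c'.2) ≤ mo.toSyn (mo.degree c.2) := by
    intro c hc v hv
    obtain ⟨c', hc', hv', hd⟩ := hex c (Or.inr hc) v hv
    exact ⟨c', hc', v, hv, hv', hd⟩
  have hnz : ∀ b ∈ SG ∪ principalSyzygies SG sp ∪ {sp}, b.2 ≠ 0 → b ∈ SG ∨ b = sp := by
    rintro b ((hb | ⟨q, -, -, rfl⟩) | hb) hb0
    · exact Or.inl hb
    · exact absurd rfl hb0
    · exact Or.inr hb
  refine ⟨?_, ?_, ?_, ?_, ?_, ?_, hinj, ?_, ?_, ?_⟩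
  · exact ((h.loopInv.finite_pairs.subset (Set.subset_insert _ _)).union
      (finite_jPairs h.loopInv.finite_basis sp)).subset hsub
  · exact (h.loopInv.finite_basis.union
      (finite_principalSyzygies h.loopInv.finite_basis sp)).union (Set.finite_singleton _)
  · intro c hc
    rcases hsub hc with hc | ⟨q, hq, -, hJ | hJ⟩
    · exact h.loopInv.value_pairs c (Or.inr hc)
    · exact hJ.isValue h.value
    · exact hJ.isValue (h.loopInv.value_basis q hq)
  · rintro b ((hb | ⟨q, hq, -, rfl⟩) | rfl)
    · exact h.loopInv.value_basis b hb
    · exact isValue_principalSyzygy h.value (h.loopInv.value_basis q hq)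
    · exact h.value
  · intro c hc
    rcases hsub hc with hc | ⟨q, hq, -, hJ | hJ⟩
    · exact h.loopInv.pair_ne_zero c (Or.inr hc)
    · exact hJ.snd_ne_zero
    · exact hJ.snd_ne_zero
  · intro c hc
    rcases hsub hc with hc | ⟨q, hq, -, hJ | hJ⟩
    · exact (h.loopInv.unit_or_tmReduces c (Or.inr hc)).imp_right
        fun h => exists_tmReduces_mono h hSG
    · exact Or.inr (hJ.exists_tmReduces (hSG hq))
    · exact Or.inr (hJ.exists_tmReduces hsp)
  · intro b hb hb0 c hc t v ht hv
    rcases hnz b hb hb0 with hb | rfl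
    · exact so.lt_of_lt_of_le (hlt b hb hb0 t ht) (hgt c hc v hv).1
    · rw [ht.unique hsps]
      exact hgt c hc v hv
  · intro p hp q hq c hc
    obtain ⟨hp0, hq0, t, t', ht, ht', hJlt, -⟩ := id hc
    have hcs := hc.isSig ht
    rcases hnz p hp hp0 with hp' | rfl <;> rcases hnz q hq hq0 with hq' | rfl
    · rcases h.loopInv.jPair p hp' q hq' c hc with ⟨c', rfl | hc', v, hv, hv', hd⟩ | hts
      · exact Or.inr (h.tsRewritable_jPair (Or.inr hirr) hp' hc hv hv' hd hsp)
      · obtain ⟨c'', hc'', hv'', hd'⟩ := hex c' (Or.inl hc') v hv'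
        exact Or.inl ⟨c'', hc'', v, hv, hv'', hd'.trans hd⟩
      · exact Or.inr (hts.mono hSG)
    · exact Or.inl (hnew c ⟨p, hp', hp0, Or.inr hc⟩ _ hcs)
    · exact Or.inl (hnew c ⟨q, hq', hq0, Or.inl hc⟩ _ hcs)
    -- No element has a J-pair with itself.
    · rw [ht.unique ht'] at hJlt
      exact absurd hJlt (so.lt_irrefl _)
  · intro i hi
    obtain ⟨b, (rfl | hb) | hb, hs⟩ := h.loopInv.unit i hi
    · exact ⟨sp, Or.inr hsp, h.isSig _ hs⟩
    · obtain ⟨c', hc', hs', -⟩ := hex b (Or.inl hb) _ hs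
      exact ⟨c', Or.inl hc', hs'⟩
    · exact ⟨b, Or.inr (hSG hb), hs⟩

lemma LoopInv.isGroebnerBasis (h : LoopInv mo so F ∅ SG) :
    IsGroebnerBasis mo (Ideal.span (Set.range F)) {g | g ≠ 0 ∧ ∃ u, (u, g) ∈ SG} := by
  refine isGroebnerBasis_of_jPairs (so := so) h.finite_basis h.value_basis
    (fun p hp q hq c hc => ?_) fun i hi => ?_
  · exact (h.jPair p hp q hq c hc).resolve_left fun ⟨c', hc', _⟩ => hc'
  · obtain ⟨b, hb | hb, hs⟩ := h.unit i hi
    · exact hb.elim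
    · exact ⟨b, hb, hs⟩

lemma exists_isMinPair (hne : CPs.Nonempty) : ∃ c, IsMinPair so CPs c := by
  by_cases h : ∃ c ∈ CPs, ∀ s, ¬ IsSig so c s
  · obtain ⟨c, hc, hs⟩ := h
    exact ⟨c, hc, fun _ _ s _ h => absurd h (hs s)⟩
  push Not at h
  obtain ⟨c₀, hc₀⟩ := hne
  obtain ⟨s₀, hs₀⟩ := h c₀ hc₀
  obtain ⟨s, ⟨c, hc, hs⟩, hmin⟩ :=
    so.wellFounded_lt.has_min {s | ∃ c ∈ CPs, IsSig so c s} ⟨s₀, c₀, hc₀, hs₀⟩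
  refine ⟨c, hc, fun c' hc' s₁ s₂ h₁ h₂ => ?_⟩
  rw [h₁.unique hs]
  by_contra hle
  exact hmin s₂ ⟨c', hc', h₂⟩ (so.lt_of_not_le hle)

/-- Ensures that the algorithm is never stuck when storing a non-syzygy. -/
lemma exists_isPruning (mo : MonomialOrder (Fin n)) (so : ModuleOrder n d)
    (C : Set (SigPoly k n d)) : ∃ C', IsPruning mo so C C' := by
  have hmin : ∀ s : {s // ∃ c ∈ C, IsSig so c s}, ∃ c ∈ C, IsSig so c s ∧
      ∀ c' ∈ C, IsSig so c' s → mo.toSyn (mo.degree c.2) ≤ mo.toSyn (mo.degree c'.2) := by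
    rintro ⟨s, c, hc, hs⟩
    obtain ⟨c, ⟨hc, hs⟩, hm⟩ := (InvImage.wf (fun x : SigPoly k n d => mo.toSyn (mo.degree x.2))
      wellFounded_lt).has_min {c | c ∈ C ∧ IsSig so c s} ⟨c, hc, hs⟩
    exact ⟨c, hc, hs, fun c' hc' hs' => not_lt.1 (hm c' ⟨hc', hs'⟩)⟩
  choose φ hφ hφs hφm using hmin
  refine ⟨Set.range φ, ?_, ?_, fun c hc s hs => ?_⟩
  · rintro _ ⟨s, rfl⟩
    exact hφ s
  · rintro _ ⟨s, rfl⟩ _ ⟨t, rfl⟩ v hv hv'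
    rw [Subtype.ext (((hφs s).unique hv).trans (hv'.unique (hφs t)))]
  · exact ⟨_, ⟨⟨s, c, hc, hs⟩, rfl⟩, hφs _, hφm ⟨s, c, hc, hs⟩ c hc hs⟩

end GVWHS

namespace GVWHS

open MvPolynomial

variable {k : Type*} [Field k] {n d : ℕ} {mo : MonomialOrder (Fin n)} {so : ModuleOrder n d}
  {F : Fin d → MvPolynomial (Fin n) k} {CPs SG : Set (SigPoly k n d)} {cp sp : SigPoly k n d}

/-! ### Termination of the main loop -/

section Termination

/-- The signatures of the non-syzygies of `SG` together with their leading exponents. -/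
def keys (mo : MonomialOrder (Fin n)) (so : ModuleOrder n d) (SG : Set (SigPoly k n d)) :
    Set (ModMon n d × (Fin n →₀ ℕ)) :=
  {x | ∃ b ∈ SG, b.2 ≠ 0 ∧ IsSig so b x.1 ∧ mo.degree b.2 = x.2}

/-- `A'` contains `A` and an element that does not dominate any element of `A`. -/
def ProperlyExtends {α : Type*} (r : α → α → Prop) (A' A : Set α) : Prop :=
  A ⊆ A' ∧ ∃ x ∈ A', ∀ y ∈ A, ¬ r y x

/-- The witnesses of an infinite chain would form a bad sequence, as each one lies in all later
sets. -/
lemma wellFounded_properlyExtends {α : Type*} {r : α → α → Prop} (hr : WellQuasiOrdered r) :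
    WellFounded (ProperlyExtends r) := by
  rw [wellFounded_iff_isEmpty_descending_chain]
  refine ⟨fun ⟨A, hA⟩ => ?_⟩
  choose hsub x hx hnot using hA
  obtain ⟨i, j, hij, h⟩ := hr x
  exact hnot j _ (monotone_nat_of_le_succ hsub (Nat.succ_le_of_lt hij) (hx i)) h

/-- Divisibility of both the signature and the leading monomial. -/
def KeyDvd (x y : ModMon n d × (Fin n →₀ ℕ)) : Prop :=
  (x.1.1 = y.1.1 ∧ x.1.2 ≤ y.1.2) ∧ x.2 ≤ y.2

lemma wellQuasiOrdered_keyDvd (n d : ℕ) :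
    WellQuasiOrdered (KeyDvd : ModMon n d × (Fin n →₀ ℕ) → _ → Prop) := by
  have : IsPreorder (ModMon n d) fun s t => s.1 = t.1 ∧ s.2 ≤ t.2 :=
    { refl := fun _ => ⟨rfl, le_rfl⟩
      trans := fun _ _ _ h h' => ⟨h.1.trans h'.1, h.2.trans h'.2⟩ }
  exact (wellQuasiOrdered_modMon n d).prod wellQuasiOrdered_le

/-- A new irreducible non-syzygy has a key that is not divisible by any previous one. -/
lemma ReduceInv.properlyExtends (hcompat : Compatible mo so) (h : ReduceInv mo so F CPs SG cp sp)
    (hirr : ∀ c, ¬ TmReduces mo so SG sp c) (h0 : sp.2 ≠ 0) :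
    ProperlyExtends KeyDvd (keys mo so (SG ∪ principalSyzygies SG sp ∪ {sp})) (keys mo so SG) := by
  obtain ⟨s, hcps, hsps⟩ := h.exists_sig
  refine ⟨fun x ⟨b, hb, hx⟩ => ⟨b, Or.inl (Or.inl hb), hx⟩, (s, mo.degree sp.2),
    ⟨sp, Or.inr rfl, h0, hsps, rfl⟩, ?_⟩
  rintro ⟨⟨i, t⟩, _⟩ ⟨b, hb, hb0, ht, rfl⟩ ⟨⟨hi, hts⟩, hd⟩
  obtain ⟨j, s⟩ := s
  dsimp only at hi hts hd ht
  subst hi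
  obtain ⟨a, rfl⟩ := exists_add_of_le hts
  obtain ⟨e, he⟩ := exists_add_of_le hd
  have hshift : ((i, t + a) : ModMon n d) = ModMon.shift a (i, t) := by
    simp [ModMon.shift, add_comm]
  rw [hshift] at hcps hsps
  have hlt := h.degree_lt hirr h0 hb hb0 ht hcps
  -- Compare the quotient `e` of the leading monomials with the quotient `a` of the signatures. If
  -- `e < a`, compatibility makes `b` tm-reduce `sp`; otherwise `b` rewrites `cp`, whose leading
  -- monomial exceeds that of `sp`.
  rcases lt_or_ge (mo.toSyn e) (mo.toSyn a) with hea | hae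
  · have hs : so.lt (ModMon.shift e (i, t)) (ModMon.shift a (i, t)) := by
      refine so.lt_of_not_le fun hle => hea.not_ge ?_
      rw [ModMon.shift, ModMon.shift, hcompat, map_add, map_add] at hle
      exact le_of_add_le_add_right hle
    obtain ⟨c, hc⟩ := exists_tmReduces h0 hb hb0 hsps ht ((add_comm _ _).trans he.symm) hs
    exact hirr c hc
  · refine h.not_tsRewritable ⟨h.loopInv.pair_ne_zero cp (Set.mem_insert _ _), b, hb, a, _, _,
      hcps, ht, rfl, Or.inr (lt_of_le_of_lt ?_ hlt)⟩
    rw [he, add_comm a, map_add, map_add]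
    exact add_le_add_right hae _

open Classical in
/-- A measure on the states of the main loop that decreases in every step. -/
noncomputable def loopMeasure (mo : MonomialOrder (Fin n)) (so : ModuleOrder n d) :
    State k n d → Set (ModMon n d × (Fin n →₀ ℕ)) × ℕ × WithBot mo.syn
  -- Doubling leaves room for the intermediate state: selecting one of `m` pairs takes `2m` to
  -- `2(m-1)+1`, and storing a syzygy then gives `2(m-1)`.
  | .loop CPs SG => (keys mo so SG, 2 * CPs.ncard, ⊥)
  | .reducing CPs SG c => (keys mo so SG, 2 * CPs.ncard + 1,
      if c.2 = 0 then ⊥ else ↑(mo.toSyn (mo.degree c.2)))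
  | _ => (∅, 0, ⊥)

/-- The lexicographic order in which `loopMeasure` decreases. -/
def LoopMeasureLT (n d : ℕ) (mo : MonomialOrder (Fin n)) :
    Set (ModMon n d × (Fin n →₀ ℕ)) × ℕ × WithBot mo.syn →
      Set (ModMon n d × (Fin n →₀ ℕ)) × ℕ × WithBot mo.syn → Prop :=
  Prod.Lex (ProperlyExtends KeyDvd) (Prod.Lex (· < ·) (· < ·))

lemma wellFounded_loopMeasureLT (n d : ℕ) (mo : MonomialOrder (Fin n)) :
    WellFounded (LoopMeasureLT n d mo) :=
  (wellFounded_properlyExtends (wellQuasiOrdered_keyDvd n d)).prod_lex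
    (wellFounded_lt.prod_lex wellFounded_lt)

end Termination

/-! ### Complete runs -/

section Run

/-- The invariant of the states after the interreduction. -/
def StateInv (mo : MonomialOrder (Fin n)) (so : ModuleOrder n d)
    (F : Fin d → MvPolynomial (Fin n) k) : State k n d → Prop
  | .interreducing _ => False
  | .loop CPs SG => LoopInv mo so F CPs SG
  | .reducing CPs SG c => ∃ cp, ReduceInv mo so F CPs SG cp c
  | .finished G => IsGroebnerBasis mo (Ideal.span (Set.range F)) G

lemma StateInv.step {S S' : State k n d} (hcompat : Compatible mo so) (h : StateInv mo so F S)
    (hS : Step mo so S S') : StateInv mo so F S' ∧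
      ((∃ G, S' = .finished G) ∨ LoopMeasureLT n d mo (loopMeasure mo so S') (loopMeasure mo so S)) := by
  cases hS with
  | interreduce => exact h.elim
  | init => exact h.elim
  | discard CPs SG cp hmin hr =>
    refine ⟨LoopInv.discard h hr, Or.inr (Prod.Lex.right _ (Prod.Lex.left _ _ ?_))⟩
    have := Set.ncard_sdiff_singleton_lt_of_mem hmin.1 h.finite_pairs
    lia
  | select CPs SG cp hmin hr =>
    refine ⟨⟨cp, LoopInv.select h hmin hr⟩, Or.inr (Prod.Lex.right _ (Prod.Lex.left _ _ ?_))⟩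
    have := Set.ncard_sdiff_singleton_lt_of_mem hmin.1 h.finite_pairs
    lia
  | tmReduce CPs SG c c' hc =>
    obtain ⟨cp, h⟩ := h
    refine ⟨⟨cp, h.tmReduce hc⟩, Or.inr (Prod.Lex.right _ (Prod.Lex.right _ ?_))⟩
    rw [if_neg hc.1]
    split_ifs with h0
    · exact WithBot.bot_lt_coe _
    · exact WithBot.coe_lt_coe.2 (hc.eq_zero_or_degree_lt.resolve_left h0)
  | storeNonzero CPs CPs' SG sp hirr h0 hprune =>
    obtain ⟨cp, h⟩ := h
    exact ⟨h.storeNonzero hirr h0 hprune,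
      Or.inr (Prod.Lex.left _ _ (h.properlyExtends hcompat hirr h0))⟩
  | storeZero CPs SG sp h0 =>
    obtain ⟨cp, h⟩ := h
    refine ⟨h.storeZero h0, Or.inr ?_⟩
    have hk : keys mo so (SG ∪ {sp}) = keys mo so SG := by
      ext x
      refine ⟨?_, fun ⟨b, hb, hx⟩ => ⟨b, Or.inl hb, hx⟩⟩
      rintro ⟨b, hb | rfl, hb0, hx⟩
      · exact ⟨b, hb, hb0, hx⟩
      · exact absurd h0 hb0
    simp only [loopMeasure, hk]
    exact Prod.Lex.right _ (Prod.Lex.left _ _ (Nat.lt_succ_self _))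
  | finish SG => exact ⟨LoopInv.isGroebnerBasis h, Or.inl ⟨_, rfl⟩⟩

lemma StateInv.acc {S : State k n d} (hcompat : Compatible mo so) (h : StateInv mo so F S) :
    Acc (fun S' S => Step mo so S S') S := by
  induction hm : loopMeasure mo so S using (wellFounded_loopMeasureLT n d mo).induction
    generalizing S with
  | _ m ih =>
  subst hm
  refine ⟨_, fun S' hS => ?_⟩
  obtain ⟨h', ⟨G, rfl⟩ | hlt⟩ := h.step hcompat hS
  · exact ⟨_, fun _ h => nomatch h⟩
  · exact ih _ hlt h' rfl

/-- A minimal pair, a tm-reduction or a pruning is always available when needed. -/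
lemma StateInv.eq_finished {S : State k n d} (h : StateInv mo so F S)
    (hS : ∀ S', ¬ Step mo so S S') : ∃ G, S = .finished G := by
  cases S with
  | interreducing => exact h.elim
  | loop CPs SG =>
    exfalso
    rcases CPs.eq_empty_or_nonempty with rfl | hne
    · exact hS _ (.finish SG)
    · obtain ⟨c, hc⟩ := exists_isMinPair (so := so) hne
      by_cases hr : TsRewritable mo so SG c
      · exact hS _ (.discard CPs SG c hc hr)
      · exact hS _ (.select CPs SG c hc hr)
  | reducing CPs SG c =>
    exfalso
    by_cases h0 : c.2 = 0
    · exact hS _ (.storeZero CPs SG c h0)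
    · have hirr : ∀ c', ¬ TmReduces mo so SG c c' := fun c' hc => hS _ (.tmReduce CPs SG c c' hc)
      obtain ⟨C', hC'⟩ := exists_isPruning mo so (CPs ∪ jPairs mo so SG c)
      exact hS _ (.storeNonzero CPs C' SG c hirr h0 hC')
  | finished G => exact ⟨G, rfl⟩

/-- The initial basis consists of syzygies only, so its J-pair conditions are vacuous. The list is
padded with zeros to length `d`. -/
lemma loopInv_init (L : List (MvPolynomial (Fin n) k)) (hL : 0 ∉ L) :
    LoopInv mo so (fun i : Fin d => L.getD i 0) (initPairs d L) (initSyzygies d L) := by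
  classical
  have hget : ∀ (i : Fin d) (hi : (i : ℕ) < L.length), L[(i : ℕ)] = L.getD i 0 := fun i hi => by
    simp [hi]
  have hSG : ∀ b ∈ initSyzygies (k := k) d L, b.2 = 0 := by
    rintro _ ⟨i, j, hi, hj, -, rfl⟩
    rfl
  refine ⟨?_, ?_, ?_, ?_, ?_, ?_, ?_, ?_, ?_, ?_⟩
  · refine (Set.finite_range fun i : Fin d =>
      ((Pi.single i 1, L.getD i 0) : SigPoly k n d)).subset ?_
    rintro _ ⟨i, hi, rfl⟩
    exact ⟨i, by rw [hget i hi]⟩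
  · refine (Set.finite_range fun x : Fin d × Fin d =>
      ((Pi.single x.2 (L.getD x.1 0) - Pi.single x.1 (L.getD x.2 0), 0) : SigPoly k n d)).subset ?_
    rintro _ ⟨i, j, hi, hj, -, rfl⟩
    exact ⟨(i, j), by rw [hget i hi, hget j hj]⟩
  · rintro _ ⟨i, hi, rfl⟩
    rw [hget i hi]
    exact isValue_single (F := fun i : Fin d => L.getD i 0) i
  · rintro _ ⟨i, j, hi, hj, -, rfl⟩
    rw [hget i hi, hget j hj]
    simp only [IsValue, Pi.sub_apply, sub_mul, Finset.sum_sub_distrib, Pi.single_apply, ite_mul,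
      zero_mul, Finset.sum_ite_eq', Finset.mem_univ, if_true]
    rw [mul_comm, sub_self]
  · rintro _ ⟨i, hi, rfl⟩ h0
    exact hL (h0 ▸ List.getElem_mem hi)
  · rintro _ ⟨i, hi, rfl⟩
    exact Or.inl ⟨i, by rw [hget i hi]⟩
  · rintro _ ⟨i, hi, rfl⟩ _ ⟨j, hj, rfl⟩ s hs hs'
    obtain rfl : i = j :=
      congrArg Prod.fst (((isSig_single i _).unique hs).trans (hs'.unique (isSig_single j _)))
    rfl
  · intro b hb hb0
    exact absurd (hSG b hb) hb0
  · intro p hp q hq c hc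
    exact absurd (hSG p hp) hc.1
  · intro i hi
    have hlt : (i : ℕ) < L.length := by
      by_contra hge
      exact hi (List.getD_eq_default _ _ (not_lt.1 hge))
    exact ⟨_, Or.inl ⟨i, hlt, rfl⟩, isSig_single i _⟩

lemma span_range_getD {L : List (MvPolynomial (Fin n) k)} (hL : L.length ≤ d) :
    Ideal.span (Set.range fun i : Fin d => L.getD i 0) = Ideal.span {f | f ∈ L} := by
  apply le_antisymm <;> rw [Ideal.span_le]
  · rintro _ ⟨i, rfl⟩
    by_cases hi : (i : ℕ) < L.length
    · refine Ideal.subset_span ?_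
      simp [hi]
    · simp [not_lt.1 hi]
  · intro f hf
    obtain ⟨i, hi, rfl⟩ := List.getElem_of_mem hf
    exact Ideal.subset_span ⟨⟨i, hi.trans_le hL⟩, by simp [hi]⟩

/-- The invariant of the whole algorithm for the ideal `I`. -/
def RunInv (mo : MonomialOrder (Fin n)) (so : ModuleOrder n d)
    (I : Ideal (MvPolynomial (Fin n) k)) (S : State k n d) : Prop :=
  (∃ M, S = .interreducing M ∧ Multiset.card M ≤ d ∧ Ideal.span {f | f ∈ M} = I) ∨
    ∃ F : Fin d → MvPolynomial (Fin n) k, Ideal.span (Set.range F) = I ∧ StateInv mo so F S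

variable {I : Ideal (MvPolynomial (Fin n) k)} {S S' : State k n d}

lemma runInv_start (f : Fin d → MvPolynomial (Fin n) k) :
    RunInv mo so (Ideal.span (Set.range f)) (start f) := by
  refine Or.inl ⟨_, rfl, by simp, ?_⟩
  congr 1
  ext g
  simp

lemma RunInv.step (hcompat : Compatible mo so) (h : RunInv mo so I S) (hS : Step mo so S S') :
    RunInv mo so I S' := by
  rcases h with ⟨M, rfl, hcard, hspan⟩ | ⟨F, hF, h⟩
  · cases hS with
    | interreduce _ M' h =>
      exact Or.inl ⟨M', rfl, h.card_le.trans hcard, h.span_eq.trans hspan⟩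
    | init _ L hred hL hsort =>
      subst hL
      refine Or.inr ⟨fun i => L.getD i 0, (span_range_getD (by simpa using hcard)).trans
        (by simpa using hspan), loopInv_init L fun h0 => ?_⟩
      -- A zero polynomial could still be dropped, so none is left.
      obtain ⟨M', hM'⟩ := Multiset.exists_cons_of_mem (Multiset.mem_coe.2 h0)
      exact hred M' (hM' ▸ .drop M')
  · exact Or.inr ⟨F, hF, (h.step hcompat hS).1⟩

lemma RunInv.acc (hcompat : Compatible mo so) (h : RunInv mo so I S) :
    Acc (fun S' S => Step mo so S S') S := by
  rcases h with ⟨M, rfl, h⟩ | ⟨F, -, h⟩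
  · induction M using (wellFounded_interreduceStep mo).induction with
    | _ M ih =>
    refine ⟨_, fun S' hS => ?_⟩
    rcases RunInv.step hcompat (Or.inl ⟨M, rfl, h⟩) hS with ⟨M', rfl, h'⟩ | ⟨F, -, h'⟩
    · cases hS with
      | interreduce _ _ hM => exact ih M' hM h'
    · exact h'.acc hcompat
  · exact h.acc hcompat

lemma RunInv.eq_finished (h : RunInv mo so I S) (hS : ∀ S', ¬ Step mo so S S') :
    ∃ G, S = .finished G ∧ IsGroebnerBasis mo I G := by
  rcases h with ⟨M, rfl, h⟩ | ⟨F, rfl, h⟩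
  · exfalso
    classical
    let r : MvPolynomial (Fin n) k → MvPolynomial (Fin n) k → Prop :=
      fun f g => mo.toSyn (mo.degree f) ≤ mo.toSyn (mo.degree g)
    have : Std.Total r := ⟨fun _ _ => le_total _ _⟩
    have : IsTrans _ r := ⟨fun _ _ _ => le_trans⟩
    -- A stuck multiset is interreduced, and sorting it enables `init`.
    refine hS _ (.init M (M.toList.insertionSort r) (fun M' hM => hS _ (.interreduce M M' hM)) ?_
      (List.pairwise_insertionSort r _))
    rw [← Multiset.coe_toList M, Multiset.coe_eq_coe, Multiset.coe_toList]
    exact List.perm_insertionSort r _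
  · obtain ⟨G, rfl⟩ := h.eq_finished hS
    exact ⟨G, rfl, h⟩

end Run

end GVWHS

theorem mainTheorem3 {k : Type*} [Field k] {n d : ℕ} (mo : MonomialOrder (Fin n))
    (so : GVWHS.ModuleOrder n d) (hcompat : GVWHS.Compatible mo so)
    (f : Fin d → MvPolynomial (Fin n) k) :
    (¬ ∃ r : ℕ → GVWHS.State k n d,
      r 0 = GVWHS.start f ∧ ∀ i, GVWHS.Step mo so (r i) (r (i + 1))) ∧
    ∀ S : GVWHS.State k n d,
      Relation.ReflTransGen (GVWHS.Step mo so) (GVWHS.start f) S →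
      (∀ S', ¬ GVWHS.Step mo so S S') →
      ∃ G, S = GVWHS.State.finished G ∧
        GVWHS.IsGroebnerBasis mo (Ideal.span (Set.range f)) G := by
  have h0 := GVWHS.runInv_start (mo := mo) (so := so) f
  refine ⟨fun ⟨r, hr, hstep⟩ => ?_, fun S hS hstuck => ?_⟩
  · exact not_acc_iff_exists_descending_chain.2 ⟨r, hr, hstep⟩ (h0.acc hcompat)
  · refine GVWHS.RunInv.eq_finished (so := so) ?_ hstuck
    clear hstuck
    induction hS with
    | refl => exact h0
    | tail _ hS ih => exact ih.step hcompat hS
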